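/- **Setting.** An auction with $N$ advertisers (ads), $K$ slots, $2\le K<N$, is repeated for $T$ rounds. Ad $i$ has a known quality $q_i\in(0,1]$, a private value per click $v_i\in[0,V]$ with $V>0$, and an *unknown* continuation probability $c_i\in[0,1]$. An allocation $\theta$ assigns the ads bijectively to the positions $1,\dots,N$, of which the first $K$ are displayed. In each round, independently, a user scans the displayed ads from the top, clicks an observed ad $i$ with probability $q_i$ and, after observing ad $i$, goes on to the next slot with probability $c_i$ (ad-dependent cascade model). So the ad in slot $m\le K$ has click-through rate $q_{\alpha(m)}\prod_{l<m}c_{\alpha(l)}$, where $\alpha(l)$ is the ad in slot $l$; $\mathrm{SW}(\theta,v)$ is the sum over the ads of click-through rate times value. With $\theta^*$ maximizing $\mathrm{SW}(\cdot,v)$, the VCG payment $p_i^*(v)$ is the maximal social welfare when ad $i$ is removed minus the contribution of the ads $j\ne i$ to $\mathrm{SW}(\theta^*,v)$. An online learning mechanism $\mathfrak A$ for $T$ rounds (possibly randomized) chooses the allocation of round $t$ from the reports up to round $t$ and the clicks observed before round $t$, and the payments of round $t$ from the reports and the clicks observed up to round $t$; it does not know the $c_i$, but may depend on $N,K,V,q$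 and $T$. It is DSIC if, for every possible realization of the users' behaviour and almost every realization of the mechanism's randomness, reporting the true value in all rounds maximizes an advertiser's cumulative utility (value of the clicks minus payments over the $T$ rounds), whatever the others report; it is individually rational (IR) if, in the same sense, an advertiser who reports truthfully has nonnegative cumulative utility; it is weakly budget balanced (WBB) if under truthful reports its expected total revenue is nonnegative for all $v\in[0,V]^N$, $c\in[0,1]^N$. Its expected revenue regret is $$R_T(\mathfrak A;v,c)=T\sum_{i=1}^N p_i^*(v)-\mathbb E\Big[\sum_{t=1}^T\sum_{i=1}^N p_{i,t}\Big],$$ where $p_{i,t}$ is the payment of advertiser $i$ in round $t$ under truthful reports and the expectation is over the users' behaviour and the mechanism's randomness. **Theorem.** Every individually rational online learning DSIC mechanism has (worst-case) expected regret over the auctioneer's revenue $R_T=\Theta(T)$. Precisely, there are constants $C_1,C_2>0$, depending only on $N,K,V,q$, such that: 1. for every $T$ and every DSIC and IR mechanism $\mathfrak A$ for $T$ rounds there are $v\in[0,V]^N$ and $c\in[0,1]^N$ with $R_T(\mathfrak A;v,c)\ge C_1T$; and if $\mathfrak A$ is also WBB, then $R_T(\mathfrak A;v,c)\le C_2T$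 for all $v\in[0,V]^N$, $c\in[0,1]^N$; 2. for every family $(\mathfrak A_T)_{T\ge 0}$ of DSIC and IR mechanisms, $\mathfrak A_T$ for $T$ rounds, there are fixed $v\in[0,V]^N$ and $c\in[0,1]^N$ with $R_T(\mathfrak A_T;v,c)\ge C_1T$ for infinitely many $T$ (so the family is not no-regret); 3. for every $T$ there is a mechanism for $T$ rounds that is DSIC, IR and WBB. -/

import Mathlib

open MeasureTheory Filter

universe u

namespace SponsoredSearch

noncomputable section

/-! ### The sponsored search auction with ad-dependent externalities

There are `N` ads and `K` slots. Slots are numbered from `0`, the topmost one; the extended slots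
`m ≥ K` are not displayed. -/

/-- An allocation: the bijection sending each extended slot to the ad placed in it. The slot of
ad `i` in `θ` is `θ.symm i`. -/
abbrev Allocation (N : ℕ) : Type := Equiv.Perm (Fin N)

/-- One real number per ad (values, reported values, payments). -/
abbrev Profile (N : ℕ) : Type := Fin N → ℝ

/-- Which ads are clicked in a round. -/
abbrev Clicks (N : ℕ) : Type := Fin N → Bool

/-- The behaviour of the user of one round towards each ad `i`: the first bit says whether the user
clicks ad `i` if it is observed, the second one whether the user, after having observed ad `i`,
goes on to the next slot. -/
abbrev UserState (N : ℕ) : Type := Fin N → Bool × Bool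

/-- Probability that the user observes slot `m` in the allocation `θ`, where `c i` is the
continuation probability of ad `i`. -/
def obsProb {N : ℕ} (K : ℕ) (c : Fin N → ℝ) (θ : Allocation N) (m : Fin N) : ℝ :=
  if (m : ℕ) < K then ∏ l ∈ Finset.Iio m, c (θ l) else 0

/-- Click-through rate of ad `i` in the allocation `θ`, where `q i` is the quality of ad `i`. -/
def ctr {N : ℕ} (K : ℕ) (q c : Fin N → ℝ) (θ : Allocation N) (i : Fin N) : ℝ :=
  obsProb K c θ (θ.symm i) * q i

/-- Social welfare of the allocation `θ` for the values `v`. -/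
def socialWelfare {N : ℕ} (K : ℕ) (q c : Fin N → ℝ) (θ : Allocation N) (v : Profile N) : ℝ :=
  ∑ i, ctr K q c θ i * v i

theorem exists_efficient {N : ℕ} (K : ℕ) (q c : Fin N → ℝ) (v : Profile N) :
    ∃ θ : Allocation N, ∀ θ' : Allocation N,
      socialWelfare K q c θ' v ≤ socialWelfare K q c θ v := by
  obtain ⟨θ, -, h⟩ := Finset.exists_max_image (Finset.univ : Finset (Allocation N))
    (fun θ => socialWelfare K q c θ v) Finset.univ_nonempty
  exact ⟨θ, fun θ' => h θ' (Finset.mem_univ _)⟩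

/-- An efficient allocation, i.e. one that maximizes the social welfare. -/
def efficientAlloc {N : ℕ} (K : ℕ) (q c : Fin N → ℝ) (v : Profile N) : Allocation N :=
  (exists_efficient K q c v).choose

/-- The largest social welfare that can be obtained when ad `i` is removed from the auction. As
`K < N`, removing an ad amounts to placing it in a slot that is not displayed. -/
def welfareWithout {N : ℕ} (K : ℕ) (q c : Fin N → ℝ) (v : Profile N) (i : Fin N) : ℝ :=
  ⨆ θ : {θ : Allocation N // K ≤ (θ.symm i : ℕ)}, socialWelfare K q c θ.1 v

/-- The (expected) VCG payment of advertiser `i`, computed with the actual parameters. -/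
def vcgPayment {N : ℕ} (K : ℕ) (q c : Fin N → ℝ) (v : Profile N) (i : Fin N) : ℝ :=
  welfareWithout K q c v i
    - ∑ j ∈ Finset.univ.erase i, ctr K q c (efficientAlloc K q c v) j * v j

/-! ### Clicks -/

/-- Ad `i` is clicked in the allocation `θ` by the user `x` iff it is displayed, the user goes on
after each of the ads displayed above it, and the user clicks it once observed. -/
def clicked {N : ℕ} (K : ℕ) (θ : Allocation N) (x : UserState N) : Clicks N := fun i =>
  decide ((θ.symm i : ℕ) < K ∧ (∀ l < θ.symm i, (x (θ l)).2 = true) ∧ (x i).1 = true)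

/-- Probability that a bit with success probability `p` takes the value `b`. -/
def bitProb (p : ℝ) (b : Bool) : ℝ := if b then p else 1 - p

/-- Probability of the realization `ω` of the users of `T` rounds: all the bits are independent,
those of ad `i` have success probabilities `q i` (click) and `c i` (continuation). -/
def realizationProb {N T : ℕ} (q c : Fin N → ℝ) (ω : Fin T → UserState N) : ℝ :=
  ∏ t, ∏ i, bitProb (q i) (ω t i).1 * bitProb (c i) (ω t i).2

/-- `c` is a vector of probabilities. -/
def IsProbVector {N : ℕ} (c : Fin N → ℝ) : Prop := ∀ i, c i ∈ Set.Icc (0 : ℝ) 1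

/-- All entries of the profile lie in the set `[0, V]` of the possible values. -/
def InRange {N : ℕ} (V : ℝ) (v : Profile N) : Prop := ∀ i, v i ∈ Set.Icc (0 : ℝ) V

/-- The realizations of the users that are possible for some value of the unknown continuation
probabilities. -/
def IsPossible {N T : ℕ} (q : Fin N → ℝ) (ω : Fin T → UserState N) : Prop :=
  ∃ c : Fin N → ℝ, IsProbVector c ∧ 0 < realizationProb q c ω

/-! ### Online learning mechanisms -/

/-- An online learning mechanism for `T` rounds. It may be randomized, through a random seed, which
the allocations and payments of all rounds may use. In each round `t` it chooses an allocation from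
the reports of the rounds up to and including `t` and the clicks observed in the previous rounds;
it then observes the clicks of round `t` and charges the advertisers. It has no access to the
continuation probabilities. -/
structure OnlineMechanism (N T : ℕ) : Type (u + 1) where
  Seed : Type u
  [measurableSpace : MeasurableSpace Seed]
  law : Measure Seed
  [isProbabilityMeasure : IsProbabilityMeasure law]
  alloc : Seed → ∀ t : Fin T, (Set.Iic t → Profile N) → (Set.Iio t → Clicks N) → Allocation N
  pay : Seed → ∀ t : Fin T, (Set.Iic t → Profile N) → (Set.Iic t → Clicks N) → Profile N
  measurable_alloc : ∀ t b h (θ : Allocation N), MeasurableSet {s | alloc s t b h = θ}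
  integrable_pay : ∀ t b h i, Integrable (fun s => pay s t b h i) law

attribute [instance] OnlineMechanism.measurableSpace OnlineMechanism.isProbabilityMeasure

namespace OnlineMechanism

variable {N T : ℕ}

/-- The clicks of round `t` when the mechanism `M` is run with seed `s` on the reports `b` (those of
round `t` are `b t`) and the users `ω`. -/
def clicksAt (M : OnlineMechanism.{u} N T) (K : ℕ) (s : M.Seed) (b : Fin T → Profile N)
    (ω : Fin T → UserState N) (t : Fin T) : Clicks N :=
  clicked K (M.alloc s t (fun r => b r) (fun r => clicksAt M K s b ω r.1)) (ω t)
termination_by t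
decreasing_by exact r.2

/-- The payments of round `t`. -/
def payAt (M : OnlineMechanism.{u} N T) (K : ℕ) (s : M.Seed) (b : Fin T → Profile N)
    (ω : Fin T → UserState N) (t : Fin T) : Profile N :=
  M.pay s t (fun r => b r) (fun r => M.clicksAt K s b ω r.1)

/-- The cumulative utility over all rounds of advertiser `i` with true value `x` per click. -/
def utility (M : OnlineMechanism.{u} N T) (K : ℕ) (s : M.Seed) (b : Fin T → Profile N)
    (ω : Fin T → UserState N) (i : Fin N) (x : ℝ) : ℝ :=
  ∑ t, ((if M.clicksAt K s b ω t i then x else 0) - M.payAt K s b ω t i)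

/-- The reports `b`, except that advertiser `i` reports `x` in every round. -/
def reporting (b : Fin T → Profile N) (i : Fin N) (x : ℝ) : Fin T → Profile N :=
  fun t => Function.update (b t) i x

/-- Dominant strategy incentive compatibility (a posteriori): for (almost) every realization of the
randomness of the mechanism and every possible realization of the users, reporting the true value
in all rounds maximizes the cumulative utility of an advertiser, whatever the others report. -/
def IsDSIC (M : OnlineMechanism.{u} N T) (K : ℕ) (V : ℝ) (q : Fin N → ℝ) : Prop :=
  ∀ᵐ s ∂M.law, ∀ ω : Fin T → UserState N, IsPossible q ω →
    ∀ b : Fin T → Profile N, (∀ t, InRange V (b t)) →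
      ∀ i : Fin N, ∀ x ∈ Set.Icc (0 : ℝ) V,
        M.utility K s b ω i x ≤ M.utility K s (reporting b i x) ω i x

/-- Individual rationality (a posteriori): an advertiser that reports the true value in all rounds
has no cumulative loss. -/
def IsIR (M : OnlineMechanism.{u} N T) (K : ℕ) (V : ℝ) (q : Fin N → ℝ) : Prop :=
  ∀ᵐ s ∂M.law, ∀ ω : Fin T → UserState N, IsPossible q ω →
    ∀ b : Fin T → Profile N, (∀ t, InRange V (b t)) →
      ∀ i : Fin N, ∀ x ∈ Set.Icc (0 : ℝ) V, 0 ≤ M.utility K s (reporting b i x) ω i x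

/-- The expected total revenue over the `T` rounds, with respect to the users and to the randomness
of the mechanism, when all the advertisers report their true values `v` in all rounds. -/
def expectedRevenue (M : OnlineMechanism.{u} N T) (K : ℕ) (q c : Fin N → ℝ) (v : Profile N) : ℝ :=
  ∑ ω : Fin T → UserState N,
    realizationProb q c ω * ∫ s, ∑ t, ∑ i, M.payAt K s (fun _ => v) ω t i ∂M.law

/-- Weak budget balance in expectation: the auctioneer has no expected loss. -/
def IsWBB (M : OnlineMechanism.{u} N T) (K : ℕ) (V : ℝ) (q : Fin N → ℝ) : Prop :=
  ∀ v c : Fin N → ℝ, InRange V v → IsProbVector c → 0 ≤ M.expectedRevenue K q c v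

/-- The expected regret over the auctioneer's revenue with respect to the VCG mechanism that is
computed with the actual parameters. -/
def regret (M : OnlineMechanism.{u} N T) (K : ℕ) (q c : Fin N → ℝ) (v : Profile N) : ℝ :=
  T * ∑ i, vcgPayment K q c v i - M.expectedRevenue K q c v

end OnlineMechanism

end

end SponsoredSearch

open SponsoredSearch

namespace SponsoredSearch

noncomputable section

/-! ### Expectations over the behaviour of the users -/

/-! Small regret leaves the advertisers almost no rent, while DSIC and IR on realizations that the
mechanism cannot tell apart force some rent to be large. In the hard instances one hub `h` has a
tiny continuation probability `γ > 0` and all other ads have 0, so a round is almost a single-slot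
auction with welfare at most `(1 + γ) * W`. In the profile `b` the hub is worth `σ` per observation
and the others 0; `a i` raises ad `i` to `W = (1 + ε) * σ`; `d i` raises the hub to `W` as well. VCG
extracts nearly all the welfare under `a i` and `d i` (`sub_sum_vcgPayment_le`), so small regret
there makes all utilities small (`expect_utility_le`).

Each round falls under one of two cases. If the hub is on top under some `a i`, it is clicked there,
and `mul_clickCount_le_utility` turns this into expected rent `ε * σ` under `d i`. Otherwise its
continuation bit is unobserved under every `a i`: setting the bit to true (`boost`) changes no click
there, hence no payment (`clicksAt_boost`). But under `b` the boosted users observe some ad other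
than the hub (`expect_boost_clicks`), and the clicks that this ad gets while reporting 0 become rent
under `a i`. Since DSIC and IR hold pathwise, the boosted realization need only be possible, which
`γ > 0` ensures; it need not be likely.

Adding the cases bounds `T` by weighted revenue gaps (`sum_revenue_gap_ge`), so one of finitely many
profiles has linear regret (`exists_hard_instances`). As these profiles and `c` do not depend on
`T`, one of them is bad for infinitely many `T`. -/

/-- Probability of the behaviour `x` of the user of one round. -/
def userProb {N : ℕ} (q c : Fin N → ℝ) (x : UserState N) : ℝ :=
  ∏ i, bitProb (q i) (x i).1 * bitProb (c i) (x i).2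

/-- Expectation over the users of `T` rounds. -/
def expect {N T : ℕ} (q c : Fin N → ℝ) (F : (Fin T → UserState N) → ℝ) : ℝ :=
  ∑ ω, realizationProb q c ω * F ω

theorem realizationProb_eq {N T : ℕ} (q c : Fin N → ℝ) (ω : Fin T → UserState N) :
    realizationProb q c ω = ∏ t, userProb q c (ω t) := rfl

theorem bitProb_nonneg {p : ℝ} (hp : p ∈ Set.Icc (0 : ℝ) 1) (b : Bool) : 0 ≤ bitProb p b := by
  unfold bitProb
  split_ifs <;> linarith [hp.1, hp.2]

/-- All bits are independent, so the mean of a product of single-bit factors splits into a product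
of means. -/
theorem sum_userProb_mul_prod {N : ℕ} (q c : Fin N → ℝ) (F G : Fin N → Bool → ℝ) :
    ∑ x : UserState N, userProb q c x * ∏ i, F i (x i).1 * G i (x i).2 =
      ∏ i, (q i * F i true + (1 - q i) * F i false) * (c i * G i true + (1 - c i) * G i false) := by
  have h := Finset.prod_univ_sum (fun _ : Fin N => (Finset.univ : Finset (Bool × Bool)))
    (fun i p => bitProb (q i) p.1 * bitProb (c i) p.2 * (F i p.1 * G i p.2))
  rw [Fintype.piFinset_univ] at h
  simp only [userProb, ← Finset.prod_mul_distrib]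
  rw [← h]
  refine Finset.prod_congr rfl fun i _ => ?_
  simp only [Fintype.sum_prod_type, Fintype.sum_bool, bitProb, if_true, Bool.false_eq_true,
    if_false]
  ring

theorem sum_userProb {N : ℕ} (q c : Fin N → ℝ) : ∑ x : UserState N, userProb q c x = 1 := by
  have h := sum_userProb_mul_prod q c (fun _ _ => 1) (fun _ _ => 1)
  simpa using h

theorem userProb_nonneg {N : ℕ} {q c : Fin N → ℝ} (hq : IsProbVector q) (hc : IsProbVector c)
    (x : UserState N) : 0 ≤ userProb q c x :=
  Finset.prod_nonneg fun i _ => mul_nonneg (bitProb_nonneg (hq i) _) (bitProb_nonneg (hc i) _)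

theorem realizationProb_nonneg {N T : ℕ} {q c : Fin N → ℝ} (hq : IsProbVector q)
    (hc : IsProbVector c) (ω : Fin T → UserState N) : 0 ≤ realizationProb q c ω :=
  Finset.prod_nonneg fun t _ => userProb_nonneg hq hc (ω t)

theorem sum_realizationProb {N T : ℕ} (q c : Fin N → ℝ) :
    ∑ ω : Fin T → UserState N, realizationProb q c ω = 1 := by
  have h := Finset.prod_univ_sum (fun _ : Fin T => (Finset.univ : Finset (UserState N)))
    (fun _ x => userProb q c x)
  rw [Fintype.piFinset_univ] at h
  simp only [realizationProb_eq]
  rw [← h]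
  simp [sum_userProb]

/-- The click bit of ad `i` has mean `q i`. -/
theorem sum_userProb_click {N : ℕ} (q c : Fin N → ℝ) (i : Fin N) :
    ∑ x : UserState N, userProb q c x * (if (x i).1 then 1 else 0) = q i := by
  have h := sum_userProb_mul_prod q c (fun j b => if j = i then (if b then 1 else 0) else 1)
    (fun _ _ => 1)
  have h2 : ∀ x : UserState N,
      (∏ j, (if j = i then (if (x j).1 then (1 : ℝ) else 0) else 1) * 1) =
        if (x i).1 then 1 else 0 := by
    intro x
    simp [Finset.prod_ite_eq']
  simp only [h2] at h
  rw [h, Finset.prod_eq_single i]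
  · simp
  · intro j _ hj
    simp [hj]
  · simp

/-- The click-through rate is the probability of a click. -/
theorem sum_userProb_clicked {N : ℕ} (K : ℕ) (q c : Fin N → ℝ) (θ : Allocation N) (i : Fin N) :
    ∑ x : UserState N, userProb q c x * (if clicked K θ x i then 1 else 0) = ctr K q c θ i := by
  by_cases hK : (θ.symm i : ℕ) < K
  -- A click is a product of bit indicators: the click bit of `i` and the continuation bits of the
  -- ads above it.
  · have h := sum_userProb_mul_prod q c (fun j b => if j = i then (if b then 1 else 0) else 1)
      (fun j b => if θ.symm j < θ.symm i then (if b then 1 else 0) else 1)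
    have h2 : ∀ x : UserState N,
        (∏ j, (if j = i then (if (x j).1 then (1 : ℝ) else 0) else 1) *
          (if θ.symm j < θ.symm i then (if (x j).2 then (1 : ℝ) else 0) else 1)) =
          if clicked K θ x i then 1 else 0 := by
      intro x
      by_cases hx : clicked K θ x i
      · rw [if_pos hx]
        simp only [clicked, decide_eq_true_eq] at hx
        refine Finset.prod_eq_one fun j _ => ?_
        have h3 : (if j = i then (if (x j).1 then (1 : ℝ) else 0) else 1) = 1 := by
          by_cases hj : j = i
          · subst hj; simp [hx.2.2]
          · simp [hj]
        have h4 : (if θ.symm j < θ.symm i then (if (x j).2 then (1 : ℝ) else 0) else 1) = 1 := by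
          by_cases hj : θ.symm j < θ.symm i
          · have := hx.2.1 _ hj
            rw [Equiv.apply_symm_apply] at this
            simp [this]
          · simp [hj]
        rw [h3, h4, one_mul]
      · rw [if_neg hx]
        simp only [clicked, decide_eq_true_eq, not_and] at hx
        by_cases hl : ∀ l < θ.symm i, (x (θ l)).2 = true
        · refine Finset.prod_eq_zero (Finset.mem_univ i) ?_
          simp [hx hK hl]
        · push Not at hl
          obtain ⟨l, hl, hl'⟩ := hl
          refine Finset.prod_eq_zero (Finset.mem_univ (θ l)) ?_
          simp [hl, hl']
    simp only [h2] at h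
    rw [h, Finset.prod_mul_distrib, mul_comm, ctr, obsProb, if_pos hK]
    congr 1
    · rw [← Equiv.prod_comp θ]
      simp only [Equiv.symm_apply_apply]
      rw [← Finset.prod_subset (Finset.subset_univ (Finset.Iio (θ.symm i)))]
      · refine Finset.prod_congr rfl fun l hl => ?_
        simp [Finset.mem_Iio.1 hl]
      · intro l _ hl
        simp [Finset.mem_Iio.not.1 hl]
    · rw [Finset.prod_eq_single i]
      · simp
      · intro j _ hj
        simp [hj]
      · simp
  · simp [clicked, ctr, obsProb, hK]

/-- The comparison is restricted to positive probability because DSIC and IR say nothing about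
impossible realizations. -/
theorem expect_mono {N T : ℕ} {q c : Fin N → ℝ} (hq : IsProbVector q) (hc : IsProbVector c)
    {F G : (Fin T → UserState N) → ℝ} (h : ∀ ω, 0 < realizationProb q c ω → F ω ≤ G ω) :
    expect q c F ≤ expect q c G := by
  refine Finset.sum_le_sum fun ω _ => ?_
  rcases (realizationProb_nonneg hq hc ω).eq_or_lt with h0 | h0
  · simp [← h0]
  · exact mul_le_mul_of_nonneg_left (h ω h0) h0.le

theorem expect_sum {N T : ℕ} {ι : Type*} (s : Finset ι) (q c : Fin N → ℝ)
    (F : ι → (Fin T → UserState N) → ℝ) :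
    expect q c (fun ω => ∑ i ∈ s, F i ω) = ∑ i ∈ s, expect q c (F i) := by
  simp only [expect, Finset.mul_sum]
  exact Finset.sum_comm

theorem expect_sub {N T : ℕ} (q c : Fin N → ℝ) (F G : (Fin T → UserState N) → ℝ) :
    expect q c (fun ω => F ω - G ω) = expect q c F - expect q c G := by
  simp only [expect, mul_sub, Finset.sum_sub_distrib]

theorem expect_const_mul {N T : ℕ} (q c : Fin N → ℝ) (a : ℝ) (F : (Fin T → UserState N) → ℝ) :
    expect q c (fun ω => a * F ω) = a * expect q c F := by
  simp only [expect, Finset.mul_sum]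
  exact Finset.sum_congr rfl fun ω _ => by ring

theorem expect_const {N T : ℕ} (q c : Fin N → ℝ) (a : ℝ) :
    expect q c (fun _ : Fin T → UserState N => a) = a := by
  simp only [expect, ← Finset.sum_mul, sum_realizationProb, one_mul]

/-- Drawing the user of round `t` anew does not change expectations. -/
theorem expect_resample {N T : ℕ} (q c : Fin N → ℝ) (t : Fin T)
    (F : (Fin T → UserState N) → ℝ) :
    expect q c F = expect q c fun ω => ∑ x, userProb q c x * F (Function.update ω t x) := by
  have hw : ∀ (ω : Fin T → UserState N) (x : UserState N),
      realizationProb q c (Function.update ω t x) * userProb q c (ω t) =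
        realizationProb q c ω * userProb q c x := by
    intro ω x
    simp only [realizationProb_eq]
    rw [← Finset.mul_prod_erase _ _ (Finset.mem_univ t),
      ← Finset.mul_prod_erase _ (fun r => userProb q c (ω r)) (Finset.mem_univ t)]
    have : ∏ r ∈ Finset.univ.erase t, userProb q c (Function.update ω t x r) =
        ∏ r ∈ Finset.univ.erase t, userProb q c (ω r) :=
      Finset.prod_congr rfl fun r hr => by
        rw [Function.update_of_ne (Finset.ne_of_mem_erase hr)]
    rw [this, Function.update_self]
    ring
  -- The involution exchanging the user of round `t` with the fresh draw; by `hw` it preserves the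
  -- joint weight.
  let e : ((Fin T → UserState N) × UserState N) ≃ ((Fin T → UserState N) × UserState N) :=
    { toFun := fun p => (Function.update p.1 t p.2, p.1 t)
      invFun := fun p => (Function.update p.1 t p.2, p.1 t)
      left_inv := fun p => by simp
      right_inv := fun p => by simp }
  calc expect q c F
      = ∑ p : (Fin T → UserState N) × UserState N,
          realizationProb q c p.1 * userProb q c p.2 * F p.1 := by
        rw [Fintype.sum_prod_type]
        refine Finset.sum_congr rfl fun ω _ => ?_
        simp only [mul_assoc, ← Finset.mul_sum, ← Finset.sum_mul, sum_userProb, one_mul]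
    _ = ∑ p : (Fin T → UserState N) × UserState N,
          realizationProb q c (e p).1 * userProb q c (e p).2 * F (e p).1 :=
        (Equiv.sum_comp e _).symm
    _ = _ := by
        rw [Fintype.sum_prod_type]
        refine Finset.sum_congr rfl fun ω _ => ?_
        rw [Finset.mul_sum]
        refine Finset.sum_congr rfl fun x _ => ?_
        change realizationProb q c (Function.update ω t x) * userProb q c (ω t) * _ = _
        rw [hw, mul_assoc]
        rfl

/-- The click bit in round `t` of an ad chosen before that round is independent of the past. -/
theorem expect_click_of_predictable {N T : ℕ} {q c : Fin N → ℝ} (hq : ∀ i, 0 < q i) (t : Fin T)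
    (j : (Fin T → UserState N) → Fin N) (G : (Fin T → UserState N) → ℝ)
    (hj : ∀ ω x, j (Function.update ω t x) = j ω) (hG : ∀ ω x, G (Function.update ω t x) = G ω) :
    expect q c (fun ω => G ω * ((q (j ω))⁻¹ * if (ω t (j ω)).1 then 1 else 0)) =
      expect q c G := by
  rw [expect_resample q c t]
  refine congrArg _ (funext fun ω => ?_)
  simp only [hj, hG, Function.update_self]
  calc _ = G ω * (q (j ω))⁻¹ *
        ∑ x : UserState N, userProb q c x * (if (x (j ω)).1 then 1 else 0) := by
        rw [Finset.mul_sum]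
        exact Finset.sum_congr rfl fun x _ => by ring
    _ = G ω := by
        rw [sum_userProb_click, mul_assoc, inv_mul_cancel₀ (hq _).ne', mul_one]

/-! ### Runs of a mechanism -/

namespace OnlineMechanism

variable {N T : ℕ}

/-- The allocation of round `t`. -/
def allocAt (M : OnlineMechanism.{u} N T) (K : ℕ) (s : M.Seed) (b : Fin T → Profile N)
    (ω : Fin T → UserState N) (t : Fin T) : Allocation N :=
  M.alloc s t (fun r => b r) (fun r => M.clicksAt K s b ω r.1)

/-- The number of clicks of ad `i`. -/
def clickCount (M : OnlineMechanism.{u} N T) (K : ℕ) (s : M.Seed) (b : Fin T → Profile N)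
    (ω : Fin T → UserState N) (i : Fin N) : ℝ :=
  ∑ t, if M.clicksAt K s b ω t i then 1 else 0

variable (M : OnlineMechanism.{u} N T) (K : ℕ) (s : M.Seed) (b : Fin T → Profile N)

theorem clicksAt_eq (ω : Fin T → UserState N) (t : Fin T) :
    M.clicksAt K s b ω t = clicked K (M.allocAt K s b ω t) (ω t) := by
  rw [clicksAt, allocAt]

/-- Users enter an allocation only through past clicks; this is why unobserved changes go
undetected. -/
theorem allocAt_congr_of_clicksAt {ω ω' : Fin T → UserState N} {t : Fin T}
    (h : ∀ r < t, M.clicksAt K s b ω r = M.clicksAt K s b ω' r) :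
    M.allocAt K s b ω t = M.allocAt K s b ω' t := by
  unfold allocAt
  congr 1
  exact funext fun r => h r.1 r.2

theorem clicksAt_congr {ω ω' : Fin T → UserState N} (t : Fin T) (h : ∀ r ≤ t, ω r = ω' r) :
    M.clicksAt K s b ω t = M.clicksAt K s b ω' t := by
  induction t using WellFoundedLT.induction with
  | ind t ih =>
    rw [clicksAt_eq, clicksAt_eq, h t le_rfl,
      M.allocAt_congr_of_clicksAt K s b fun r hr => ih r hr fun r' hr' => h r' (hr'.trans hr.le)]

theorem allocAt_congr {ω ω' : Fin T → UserState N} (t : Fin T) (h : ∀ r < t, ω r = ω' r) :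
    M.allocAt K s b ω t = M.allocAt K s b ω' t :=
  M.allocAt_congr_of_clicksAt K s b fun r hr =>
    M.clicksAt_congr K s b r fun r' hr' => h r' (hr'.trans_lt hr)

theorem allocAt_update (ω : Fin T → UserState N) (t : Fin T) (x : UserState N) :
    M.allocAt K s b (Function.update ω t x) t = M.allocAt K s b ω t :=
  M.allocAt_congr K s b t fun _ hr => Function.update_of_ne hr.ne _ _

theorem utility_eq (ω : Fin T → UserState N) (i : Fin N) (x : ℝ) :
    M.utility K s b ω i x = x * M.clickCount K s b ω i - ∑ t, M.payAt K s b ω t i := by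
  simp only [utility, clickCount, Finset.sum_sub_distrib, Finset.mul_sum, mul_ite, mul_one,
    mul_zero]

theorem utility_congr {ω ω' : Fin T → UserState N}
    (h : ∀ t, M.clicksAt K s b ω t = M.clicksAt K s b ω' t) (i : Fin N) (x : ℝ) :
    M.utility K s b ω i x = M.utility K s b ω' i x := by
  have h' : M.clicksAt K s b ω = M.clicksAt K s b ω' := funext h
  simp only [utility, payAt, h']

/-- Lower bound on the truthful utility from the clicks that a lower report would attract. -/
theorem mul_clickCount_le_utility {V : ℝ} {ω : Fin T → UserState N}
    (hD : ∀ b : Fin T → Profile N, (∀ t, InRange V (b t)) →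
      ∀ i : Fin N, ∀ x ∈ Set.Icc (0 : ℝ) V,
        M.utility K s b ω i x ≤ M.utility K s (reporting b i x) ω i x)
    (hI : ∀ b : Fin T → Profile N, (∀ t, InRange V (b t)) →
      ∀ i : Fin N, ∀ x ∈ Set.Icc (0 : ℝ) V, 0 ≤ M.utility K s (reporting b i x) ω i x)
    {v : Profile N} (hv : InRange V v) (i : Fin N) {x : ℝ} (hx : x ∈ Set.Icc (0 : ℝ) V) :
    (x - v i) * M.clickCount K s (fun _ => v) ω i ≤
      M.utility K s (fun _ => Function.update v i x) ω i x := by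
  -- An advertiser with value `x` could report `v i`, and IR for the value `v i` caps the payments
  -- made there at `v i` per click.
  have h1 := hD (fun _ => v) (fun _ => hv) i x hx
  have h2 := hI (fun _ => v) (fun _ => hv) i (v i) (hv i)
  have h3 : reporting (fun _ : Fin T => v) i (v i) = fun _ => v := by
    funext t
    simp [reporting]
  rw [h3, utility_eq] at h2
  rw [utility_eq] at h1
  change _ ≤ M.utility K s (fun _ => Function.update v i x) ω i x at h1
  linarith

/-- The expected welfare of a run does not exceed `T` times the maximal welfare of a round. -/
theorem expect_welfare_le {q c : Fin N → ℝ} (hq : IsProbVector q) (hc : IsProbVector c)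
    (v : Profile N) {B : ℝ} (hB : ∀ θ : Allocation N, socialWelfare K q c θ v ≤ B) :
    expect q c (fun ω => ∑ i, v i * M.clickCount K s b ω i) ≤ T * B := by
  have h : ∀ t : Fin T, expect q c
      (fun ω => ∑ i, v i * if M.clicksAt K s b ω t i then 1 else 0) ≤ B := by
    intro t
    -- Given the past, the allocation of round `t` is fixed, so averaging over a fresh user turns
    -- clicks into click-through rates.
    rw [expect_resample q c t]
    refine (expect_mono hq hc fun ω _ => ?_).trans_eq (expect_const q c B)
    refine le_of_eq_of_le ?_ (hB (M.allocAt K s b ω t))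
    simp only [clicksAt_eq, allocAt_update, Function.update_self, socialWelfare,
      ← sum_userProb_clicked, Finset.mul_sum, Finset.sum_mul]
    rw [Finset.sum_comm]
    exact Finset.sum_congr rfl fun i _ => Finset.sum_congr rfl fun x _ => by ring
  calc _ = expect q c (fun ω => ∑ t, ∑ i, v i * if M.clicksAt K s b ω t i then 1 else 0) := by
        refine congrArg _ (funext fun ω => ?_)
        simp only [clickCount, Finset.mul_sum]
        exact Finset.sum_comm
    _ ≤ ∑ _t : Fin T, B := by
        rw [expect_sum]
        exact Finset.sum_le_sum fun t _ => h t
    _ = T * B := by simp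

/-- The expected number of clicks of an ad is at least its quality times the expected number of
rounds in which it is in the top slot. -/
theorem expect_top_le {q c : Fin N → ℝ} (hq : ∀ i, q i ∈ Set.Ioc (0 : ℝ) 1)
    (hc : IsProbVector c) {m : Fin N} (hm : (m : ℕ) = 0) (hK : 0 < K) (h : Fin N) :
    ∑ t, expect q c (fun ω => if M.allocAt K s b ω t m = h then 1 else 0) ≤
      (q h)⁻¹ * expect q c (fun ω => M.clickCount K s b ω h) := by
  have hq' : IsProbVector q := fun i => ⟨(hq i).1.le, (hq i).2⟩
  have hm' : ∀ l : Fin N, ¬ l < m := fun l hl => by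
    have := Fin.lt_def.1 hl
    omega
  unfold clickCount
  rw [expect_sum, Finset.mul_sum]
  refine Finset.sum_le_sum fun t _ => ?_
  -- The top slot is decided before the click bit is drawn, so weighting that bit by `(q h)⁻¹` keeps
  -- the mean.
  rw [← expect_click_of_predictable (fun i => (hq i).1) t (fun _ => h) _ (fun _ _ => rfl)
    (fun ω x => by simp only [allocAt_update]), ← expect_const_mul]
  refine expect_mono hq' hc fun ω _ => ?_
  have hinv := inv_pos.2 (hq h).1
  by_cases htop : M.allocAt K s b ω t m = h
  · by_cases hx : (ω t h).1
    · have : M.clicksAt K s b ω t h = true := by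
        rw [clicksAt_eq]
        have : (M.allocAt K s b ω t).symm h = m := by rw [Equiv.symm_apply_eq, htop]
        simp only [clicked, this, hm, hx, decide_eq_true_eq]
        exact ⟨hK, fun l hl => (hm' l hl).elim, trivial⟩
      simp [htop, hx, this]
    · rw [if_pos htop, if_neg hx]
      split_ifs <;> simp [hinv.le]
  · rw [if_neg htop]
    split_ifs <;> simp [hinv.le]

end OnlineMechanism

/-! ### Unobserved changes of the users -/

open Classical in
/-- The realization `ω`, except that in the rounds of `g` the users go on after ad `h`. -/
def boost {N T : ℕ} (h : Fin N) (g : (Fin T → UserState N) → Fin T → Prop)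
    (ω : Fin T → UserState N) : Fin T → UserState N :=
  fun t => if g ω t then Function.update (ω t) h ((ω t h).1, true) else ω t

variable {N T : ℕ} {h : Fin N} {g : (Fin T → UserState N) → Fin T → Prop}

theorem boost_click (ω : Fin T → UserState N) (t : Fin T) (j : Fin N) :
    (boost h g ω t j).1 = (ω t j).1 := by
  unfold boost
  split_ifs
  · by_cases hj : j = h
    · subst hj; simp
    · simp [hj]
  · rfl

theorem boost_of_ne (ω : Fin T → UserState N) (t : Fin T) {j : Fin N} (hj : j ≠ h) :
    boost h g ω t j = ω t j := by
  unfold boost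
  split_ifs
  · simp [hj]
  · rfl

theorem boost_hub {ω : Fin T → UserState N} {t : Fin T} (hg : g ω t) :
    (boost h g ω t h).2 = true := by
  simp [boost, hg]

theorem realizationProb_pos_iff {q c : Fin N → ℝ} (hq : IsProbVector q) (hc : IsProbVector c)
    (ω : Fin T → UserState N) :
    0 < realizationProb q c ω ↔
      ∀ t i, bitProb (q i) (ω t i).1 ≠ 0 ∧ bitProb (c i) (ω t i).2 ≠ 0 := by
  rw [lt_iff_le_and_ne, and_iff_right (realizationProb_nonneg hq hc ω), ne_comm]
  simp [realizationProb, Finset.prod_eq_zero_iff, not_or]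

/-- Only bits of `h` change, and only to true, which `0 < c h` allows. -/
theorem realizationProb_boost_pos {q c : Fin N → ℝ} (hq : IsProbVector q) (hc : IsProbVector c)
    (hh : 0 < c h) {ω : Fin T → UserState N} (hω : 0 < realizationProb q c ω) :
    0 < realizationProb q c (boost h g ω) := by
  rw [realizationProb_pos_iff hq hc] at hω ⊢
  intro t i
  rw [boost_click]
  refine ⟨(hω t i).1, ?_⟩
  by_cases hi : i = h
  · subst hi
    by_cases hg : g ω t
    · rw [boost_hub hg]
      simpa [bitProb] using hh.ne'
    · simpa [boost, hg] using (hω t i).2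
  · rw [boost_of_ne ω t hi]
    exact (hω t i).2

theorem not_continue_of_pos {q c : Fin N → ℝ} (hq : IsProbVector q) (hc : IsProbVector c)
    {ω : Fin T → UserState N} (hω : 0 < realizationProb q c ω) {i : Fin N} (hi : c i = 0)
    (t : Fin T) : (ω t i).2 = false := by
  have h2 := ((realizationProb_pos_iff hq hc ω).1 hω t i).2
  rw [hi] at h2
  by_contra h3
  simp [bitProb, h3] at h2

/-- If the users never go on after an ad other than `h`, a change of the continuation bit of `h` in
rounds in which `h` is not in the top slot is not observed. -/
theorem clicksAt_boost (M : OnlineMechanism.{u} N T) (K : ℕ) (s : M.Seed) (b : Fin T → Profile N)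
    {m : Fin N} (hm : (m : ℕ) = 0) {ω : Fin T → UserState N}
    (hg : ∀ t, g ω t → M.allocAt K s b ω t m ≠ h)
    (hω : ∀ t, ∀ j ≠ h, (ω t j).2 = false) (t : Fin T) :
    M.clicksAt K s b (boost h g ω) t = M.clicksAt K s b ω t := by
  induction t using WellFoundedLT.induction with
  | ind t ih =>
    rw [M.clicksAt_eq, M.clicksAt_eq, M.allocAt_congr_of_clicksAt K s b ih]
    by_cases hgt : g ω t
    · set θ := M.allocAt K s b ω t with hθ
      funext j
      unfold clicked
      rw [boost_click]
      congr 1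
      -- Below the top slot nothing is observed with or without the boost, since the user stops at a
      -- top ad other than `h`; the top slot depends on no continuation bit.
      by_cases hj : m < θ.symm j
      · have h1 : ¬ ∀ l < θ.symm j, (boost h g ω t (θ l)).2 = true := fun hl => by
          have := hl m hj
          rw [boost_of_ne ω t (hg t hgt), hω t _ (hg t hgt)] at this
          exact Bool.noConfusion this
        have h2 : ¬ ∀ l < θ.symm j, (ω t (θ l)).2 = true := fun hl => by
          have := hl m hj
          rw [hω t _ (hg t hgt)] at this
          exact Bool.noConfusion this
        simp only [h1, h2]
      · have h0 : ∀ l : Fin N, ¬ l < θ.symm j := fun l hl => by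
          rw [Fin.lt_def] at hl hj
          omega
        simp [h0]
    · have : boost h g ω t = ω t := by simp [boost, hgt]
      rw [this]

/-- In the rounds of `g`, the first ad other than `h` is observed by the users of `boost h g ω`. -/
theorem expect_boost_clicks (M : OnlineMechanism.{u} N T) (K : ℕ) (hK : 2 ≤ K) (s : M.Seed)
    (b : Fin T → Profile N) {m m' : Fin N} (hm : (m : ℕ) = 0) (hm' : (m' : ℕ) = 1)
    {q c : Fin N → ℝ} (hq : ∀ i, q i ∈ Set.Ioc (0 : ℝ) 1) (hc : IsProbVector c)
    (hg : ∀ ω ω' : Fin T → UserState N, ∀ t, (∀ r < t, ω r = ω' r) → (g ω t ↔ g ω' t))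
    [∀ ω t, Decidable (g ω t)] :
    ∑ t, expect q c (fun ω => if g ω t then 1 else 0) ≤
      ∑ i ∈ Finset.univ.erase h,
        (q i)⁻¹ * expect q c (fun ω => M.clickCount K s b (boost h g ω) i) := by
  have hq' : IsProbVector q := fun i => ⟨(hq i).1.le, (hq i).2⟩
  have hne : m ≠ m' := fun e => by
    rw [e, hm'] at hm
    omega
  have hpast : ∀ (ω : Fin T → UserState N) (t : Fin T) (x : UserState N), ∀ r < t,
      Function.update ω t x r = ω r := fun ω t x r hr => Function.update_of_ne hr.ne _ _
  have hboost : ∀ (ω : Fin T → UserState N) (t : Fin T) (x : UserState N), ∀ r < t,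
      boost h g (Function.update ω t x) r = boost h g ω r := by
    intro ω t x r hr
    have h1 : g (Function.update ω t x) r ↔ g ω r :=
      hg _ _ _ fun r' hr' => hpast ω t x r' (hr'.trans hr)
    by_cases hgr : g ω r <;> simp [boost, h1, hpast ω t x r hr, hgr]
  let θ : (Fin T → UserState N) → Fin T → Allocation N := fun ω t =>
    M.allocAt K s b (boost h g ω) t
  have hθ : ∀ ω t x, θ (Function.update ω t x) t = θ ω t := fun ω t x =>
    M.allocAt_congr K s b t fun r hr => hboost ω t x r hr
  -- The highest-placed ad other than `h`; it is known before round `t`.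
  let j : Fin T → (Fin T → UserState N) → Fin N := fun t ω =>
    if θ ω t m = h then θ ω t m' else θ ω t m
  have hjh : ∀ t ω, j t ω ≠ h := by
    intro t ω
    by_cases htop : θ ω t m = h
    · simp only [j, if_pos htop]
      rw [← htop]
      exact fun e => hne ((θ ω t).injective e).symm
    · simpa only [j, if_neg htop] using htop
  have hclick : ∀ ω t, g ω t → (ω t (j t ω)).1 = true →
      M.clicksAt K s b (boost h g ω) t (j t ω) = true := by
    intro ω t hgt hx
    rw [M.clicksAt_eq]
    change clicked K (θ ω t) _ _ = true
    simp only [clicked, decide_eq_true_eq, boost_click, hx, and_true]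
    by_cases htop : θ ω t m = h
    · have h1 : (θ ω t).symm (j t ω) = m' := by simp [j, htop]
      -- `2 ≤ K` displays the second slot, and the boost carries the user past the hub above it.
      rw [h1, hm']
      refine ⟨by omega, fun l hl => ?_⟩
      have : l = m := by
        ext
        rw [Fin.lt_def] at hl
        omega
      rw [this, htop, boost_hub hgt]
    · have h1 : (θ ω t).symm (j t ω) = m := by simp [j, htop]
      rw [h1, hm]
      refine ⟨by omega, fun l hl => ?_⟩
      rw [Fin.lt_def] at hl
      omega
  simp only [OnlineMechanism.clickCount, expect_sum, Finset.mul_sum]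
  rw [Finset.sum_comm]
  refine Finset.sum_le_sum fun t _ => ?_
  rw [← expect_click_of_predictable (fun i => (hq i).1) t (j t) _
    (fun ω x => by simp only [j, hθ])
    (fun ω x => by simp only [hg _ _ t (hpast ω t x)])]
  simp only [← expect_const_mul]
  rw [← expect_sum]
  refine expect_mono hq' hc fun ω _ => ?_
  have hnn : ∀ i ∈ Finset.univ.erase h,
      0 ≤ (q i)⁻¹ * if M.clicksAt K s b (boost h g ω) t i = true then (1 : ℝ) else 0 := by
    intro i _
    have := inv_pos.2 (hq i).1
    split_ifs <;> simp [this.le]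
  by_cases hgt : g ω t
  · by_cases hx : (ω t (j t ω)).1
    · refine le_of_eq_of_le ?_ (Finset.single_le_sum hnn
        (Finset.mem_erase.2 ⟨hjh t ω, Finset.mem_univ _⟩))
      simp [hgt, hx, hclick ω t hgt hx]
    · simpa [hgt, hx] using Finset.sum_nonneg hnn
  · simpa [hgt] using Finset.sum_nonneg hnn

/-! ### Welfare and VCG payments -/

section Welfare

variable {N K : ℕ} {q c : Fin N → ℝ}

theorem obsProb_nonneg (K : ℕ) (hc : IsProbVector c) (θ : Allocation N) (m : Fin N) :
    0 ≤ obsProb K c θ m := by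
  unfold obsProb
  split_ifs
  · exact Finset.prod_nonneg fun l _ => (hc _).1
  · exact le_rfl

theorem obsProb_le_one (K : ℕ) (hc : IsProbVector c) (θ : Allocation N) (m : Fin N) :
    obsProb K c θ m ≤ 1 := by
  unfold obsProb
  split_ifs
  · exact Finset.prod_le_one (fun l _ => (hc _).1) fun l _ => (hc _).2
  · exact zero_le_one

theorem ctr_mul_nonneg (hq : IsProbVector q) (hc : IsProbVector c) (θ : Allocation N) (i : Fin N)
    {x : ℝ} (hx : 0 ≤ x) : 0 ≤ ctr K q c θ i * x :=
  mul_nonneg (mul_nonneg (obsProb_nonneg K hc θ _) (hq i).1) hx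

theorem socialWelfare_le_card_mul (hq : IsProbVector q) (hc : IsProbVector c) {V : ℝ}
    {v : Profile N} (hv : InRange V v) (θ : Allocation N) :
    socialWelfare K q c θ v ≤ N * V := by
  calc socialWelfare K q c θ v ≤ ∑ _i : Fin N, V := by
        refine Finset.sum_le_sum fun i _ => ?_
        have h1 : ctr K q c θ i ≤ 1 :=
          mul_le_one₀ (obsProb_le_one K hc θ _) (hq i).1 (hq i).2
        exact (mul_le_of_le_one_left (hv i).1 h1).trans (hv i).2
    _ = N * V := by simp

theorem exists_alloc_first_last {m l j k : Fin N} (hml : m ≠ l) (hjk : j ≠ k) :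
    ∃ θ : Allocation N, θ m = k ∧ θ l = j := by
  have h1 : m ≠ (Equiv.swap m k).symm j := by
    rw [Ne, Equiv.eq_symm_apply, Equiv.swap_apply_left]
    exact hjk.symm
  refine ⟨(Equiv.swap l ((Equiv.swap m k).symm j)).trans (Equiv.swap m k), ?_, ?_⟩
  · rw [Equiv.trans_apply, Equiv.swap_apply_of_ne_of_ne hml h1, Equiv.swap_apply_left]
  · rw [Equiv.trans_apply, Equiv.swap_apply_left, Equiv.apply_symm_apply]

/-- Place `k` on top and `j` in the last slot, which `K < N` hides; the other ads contribute
nonnegatively. -/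
theorem le_welfareWithout (hK : 0 < K) (hKN : K < N) (hq : IsProbVector q) (hc : IsProbVector c)
    {v : Profile N} (hv : ∀ i, 0 ≤ v i) {j k : Fin N} (hjk : j ≠ k) :
    q k * v k ≤ welfareWithout K q c v j := by
  let m : Fin N := ⟨0, by omega⟩
  let l : Fin N := ⟨N - 1, by omega⟩
  have hml : m ≠ l := by
    rw [Ne, Fin.ext_iff]
    simp only [m, l]
    omega
  obtain ⟨θ, hθm, hθl⟩ := exists_alloc_first_last hml hjk
  have hj : K ≤ (θ.symm j : ℕ) := by
    rw [← hθl, Equiv.symm_apply_apply]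
    simp only [l]
    omega
  refine le_trans ?_ (le_ciSup (f := fun θ : {θ : Allocation N // K ≤ (θ.symm j : ℕ)} =>
    socialWelfare K q c θ.1 v) (Set.finite_range _).bddAbove ⟨θ, hj⟩)
  refine le_of_eq_of_le ?_ (Finset.single_le_sum
    (fun i _ => ctr_mul_nonneg (K := K) hq hc θ i (hv i)) (Finset.mem_univ k))
  have h1 : θ.symm k = m := by rw [← hθm, Equiv.symm_apply_apply]
  have h2 : Finset.Iio m = ∅ := by
    ext x
    simp [Fin.lt_def, m]
  simp [ctr, h1, obsProb, h2, m, hK]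

theorem welfareWithout_le (hK : 0 < K) (hKN : K < N) {v : Profile N} {B : ℝ}
    (hB : ∀ θ : Allocation N, socialWelfare K q c θ v ≤ B) (j : Fin N) :
    welfareWithout K q c v j ≤ B := by
  -- A real supremum over an empty index defaults to 0, so an allocation hiding `j` must be
  -- exhibited.
  have hne : Nonempty {θ : Allocation N // K ≤ (θ.symm j : ℕ)} := by
    refine ⟨⟨Equiv.swap ⟨N - 1, by omega⟩ j, ?_⟩⟩
    simp only [Equiv.symm_swap, Equiv.swap_apply_right]
    omega
  exact ciSup_le fun θ => hB θ.1

theorem sum_vcgPayment_le (hK : 0 < K) (hKN : K < N) (hq : IsProbVector q) (hc : IsProbVector c)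
    {V : ℝ} {v : Profile N} (hv : InRange V v) :
    ∑ i, vcgPayment K q c v i ≤ N * (N * V) := by
  calc ∑ i, vcgPayment K q c v i ≤ ∑ _i : Fin N, (N * V : ℝ) := by
        refine Finset.sum_le_sum fun i _ => (sub_le_self _ ?_).trans
          (welfareWithout_le hK hKN (socialWelfare_le_card_mul hq hc hv) i)
        exact Finset.sum_nonneg fun j _ => ctr_mul_nonneg hq hc _ j (hv j).1
    _ = N * (N * V) := by simp

/-- If the welfare is at most `B`, the welfare not extracted by the VCG payments is at most the sum
of the externalities computed with `B`. -/
theorem sub_sum_vcgPayment_le (hN : 0 < N) {v : Profile N} {B : ℝ}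
    (hB : ∀ θ : Allocation N, socialWelfare K q c θ v ≤ B) :
    B - ∑ i, vcgPayment K q c v i ≤ ∑ i, (B - welfareWithout K q c v i) := by
  set S := socialWelfare K q c (efficientAlloc K q c v) v with hS
  have h1 : ∑ i, vcgPayment K q c v i = ∑ i, welfareWithout K q c v i - N * S + S := by
    -- Each payment is `welfareWithout - S` plus the ad's own share of `S`, so the sum loses `N - 1`
    -- copies of `S`, each at most `B`.
    have h2 : ∀ i, vcgPayment K q c v i = welfareWithout K q c v i - S +
        ctr K q c (efficientAlloc K q c v) i * v i := by
      intro i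
      have := Finset.add_sum_erase Finset.univ
        (fun j => ctr K q c (efficientAlloc K q c v) j * v j) (Finset.mem_univ i)
      rw [vcgPayment, hS, socialWelfare, ← this]
      ring
    simp only [h2, Finset.sum_add_distrib, Finset.sum_sub_distrib, Finset.sum_const,
      Finset.card_univ, Fintype.card_fin, nsmul_eq_mul]
    rw [hS, socialWelfare]
  have h3 : (1 : ℝ) ≤ N := by exact_mod_cast hN
  have h4 : S ≤ B := hB _
  rw [h1, Finset.sum_sub_distrib]
  simp only [Finset.sum_const, Finset.card_univ, Fintype.card_fin, nsmul_eq_mul]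
  nlinarith

/-- Bound on the welfare if the users go on after at most one of the ads. -/
theorem socialWelfare_le_of_hub (hN : 2 ≤ N) (hc : IsProbVector c) {h : Fin N}
    (hh : ∀ i ≠ h, c i = 0) {v : Profile N} {W : ℝ} (hW : 0 ≤ W) (hv : ∀ i, q i * v i ≤ W)
    (θ : Allocation N) : socialWelfare K q c θ v ≤ (1 + c h) * W := by
  let m₀ : Fin N := ⟨0, by omega⟩
  let m₁ : Fin N := ⟨1, by omega⟩
  have hle : ∀ i, c i ≤ c h := fun i => by
    by_cases hi : i = h
    · rw [hi]
    · rw [hh i hi]; exact (hc h).1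
  have hobs : ∀ m, obsProb K c θ m ≤ (if m = m₀ then 1 else 0) + (if m = m₁ then c h else 0) := by
    intro m
    by_cases h0 : m = m₀
    · have : m ≠ m₁ := by
        rw [h0, Ne, Fin.ext_iff]
        simp [m₀, m₁]
      simpa [h0, m₀, m₁] using obsProb_le_one K hc θ m₀
    · have hm0 : (m : ℕ) ≠ 0 := fun e => h0 (Fin.ext e)
      have hlt : m₀ ∈ Finset.Iio m := Finset.mem_Iio.2 (Fin.lt_def.2 (by simp only [m₀]; omega))
      unfold obsProb
      rw [← Finset.mul_prod_erase _ _ hlt]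
      by_cases h1 : m = m₁
      · rw [if_neg h0, if_pos h1, zero_add]
        split_ifs
        · exact (mul_le_of_le_one_right (hc _).1
            (Finset.prod_le_one (fun l _ => (hc _).1) fun l _ => (hc _).2)).trans (hle _)
        · exact (hc h).1
      · have hm1 : (m : ℕ) ≠ 1 := fun e => h1 (Fin.ext e)
        have hmem : m₁ ∈ (Finset.Iio m).erase m₀ := by
          refine Finset.mem_erase.2 ⟨?_, Finset.mem_Iio.2 (Fin.lt_def.2 ?_)⟩
          · rw [Ne, Fin.ext_iff]
            simp [m₀, m₁]
          · simp only [m₁]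
            omega
        -- Reaching a third slot requires two ads that let the user go on, but only `h` can.
        have hz : c (θ m₀) * ∏ l ∈ (Finset.Iio m).erase m₀, c (θ l) = 0 := by
          by_cases ht : θ m₀ = h
          · refine mul_eq_zero_of_right _ (Finset.prod_eq_zero hmem (hh _ fun e => ?_))
            have := θ.injective (e.trans ht.symm)
            rw [Fin.ext_iff] at this
            simp [m₀, m₁] at this
          · rw [hh _ ht, zero_mul]
        simp [h0, h1, hz]
  calc socialWelfare K q c θ v = ∑ m, obsProb K c θ m * (q (θ m) * v (θ m)) := by
        rw [socialWelfare, ← Equiv.sum_comp θ]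
        simp only [ctr, Equiv.symm_apply_apply, mul_assoc]
    _ ≤ ∑ m, ((if m = m₀ then 1 else 0) + (if m = m₁ then c h else 0)) * W := by
        refine Finset.sum_le_sum fun m _ => ?_
        exact (mul_le_mul_of_nonneg_left (hv _) (obsProb_nonneg K hc θ m)).trans
          (mul_le_mul_of_nonneg_right (hobs m) hW)
    _ = (1 + c h) * W := by
        rw [← Finset.sum_mul, Finset.sum_add_distrib]
        simp

end Welfare

/-! ### Revenue of a mechanism for a fixed seed -/

namespace OnlineMechanism

variable {N T : ℕ} (M : OnlineMechanism.{u} N T) (K : ℕ)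

/-- Only finitely many click histories and allocations exist, so the event is a finite union over
them. -/
theorem measurableSet_clicksAt (b : Fin T → Profile N) (ω : Fin T → UserState N) (t : Fin T)
    (z : Clicks N) : MeasurableSet {s | M.clicksAt K s b ω t = z} := by
  induction t using WellFoundedLT.induction generalizing z with
  | ind t ih =>
    have h : {s | M.clicksAt K s b ω t = z} =
        ⋃ H : Set.Iio t → Clicks N, ⋃ θ ∈ {θ : Allocation N | clicked K θ (ω t) = z},
          (⋂ r : Set.Iio t, {s | M.clicksAt K s b ω r = H r}) ∩
            {s | M.alloc s t (fun r => b r) H = θ} := by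
      ext s
      simp only [Set.mem_ofPred_eq, Set.mem_iUnion, Set.mem_inter_iff, Set.mem_iInter, exists_prop]
      rw [clicksAt_eq]
      constructor
      · intro hs
        exact ⟨fun r => M.clicksAt K s b ω r, _, hs, fun _ => rfl, rfl⟩
      · rintro ⟨H, θ, hθ, hH, rfl⟩
        rw [← hθ]
        unfold allocAt
        simp only [hH]
    rw [h]
    refine MeasurableSet.iUnion fun H => ?_
    refine (Set.toFinite _).measurableSet_biUnion fun θ _ => ?_
    exact (MeasurableSet.iInter fun r : Set.Iio t => ih r.1 r.2 _).inter (M.measurable_alloc t _ H θ)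

theorem integrable_payAt (b : Fin T → Profile N) (ω : Fin T → UserState N) (t : Fin T)
    (i : Fin N) : Integrable (fun s => M.payAt K s b ω t i) M.law := by
  have h : (fun s => M.payAt K s b ω t i) = fun s => ∑ H : Set.Iic t → Clicks N,
      (⋂ r : Set.Iic t, {s | M.clicksAt K s b ω r = H r}).indicator
        (fun s => M.pay s t (fun r => b r) H i) s := by
    funext s
    rw [Finset.sum_eq_single fun r : Set.Iic t => M.clicksAt K s b ω r]
    · rw [Set.indicator_of_mem (by simp)]
      rfl
    · intro H _ hH
      refine Set.indicator_of_notMem (fun hs => hH ?_) _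
      simp only [Set.mem_iInter, Set.mem_ofPred_eq] at hs
      exact funext fun r => (hs r).symm
    · simp
  rw [h]
  refine integrable_finsetSum _ fun H _ => (M.integrable_pay t _ H i).indicator ?_
  exact MeasurableSet.iInter fun r => M.measurableSet_clicksAt K b ω r _

/-- The expected total revenue for the seed `s` under the truthful reports `v`. -/
def seedRevenue (q c : Fin N → ℝ) (v : Profile N) (s : M.Seed) : ℝ :=
  expect q c fun ω => ∑ t, ∑ i, M.payAt K s (fun _ => v) ω t i

theorem integrable_seedRevenue (q c : Fin N → ℝ) (v : Profile N) :
    Integrable (M.seedRevenue K q c v) M.law :=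
  integrable_finsetSum _ fun ω _ => Integrable.const_mul (integrable_finsetSum _ fun t _ =>
    integrable_finsetSum _ fun i _ => M.integrable_payAt K _ ω t i) _

theorem integral_seedRevenue (q c : Fin N → ℝ) (v : Profile N) :
    ∫ s, M.seedRevenue K q c v s ∂M.law = M.expectedRevenue K q c v := by
  unfold seedRevenue expect expectedRevenue
  rw [integral_finsetSum]
  · exact Finset.sum_congr rfl fun ω _ => integral_const_mul _ _
  · exact fun ω _ => Integrable.const_mul (integrable_finsetSum _ fun t _ =>
      integrable_finsetSum _ fun i _ => M.integrable_payAt K _ ω t i) _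

variable {M K} {V : ℝ} {q c : Fin N → ℝ} {s : M.Seed}

/-- Under individual rationality, the revenue is at most the welfare minus the utility of one
advertiser. -/
theorem expect_utility_le (hq : IsProbVector q) (hc : IsProbVector c)
    (hI : ∀ ω : Fin T → UserState N, IsPossible q ω →
      ∀ b : Fin T → Profile N, (∀ t, InRange V (b t)) → ∀ i : Fin N, ∀ x ∈ Set.Icc (0 : ℝ) V,
        0 ≤ M.utility K s (reporting b i x) ω i x)
    {v : Profile N} (hv : InRange V v) {B : ℝ}
    (hB : ∀ θ : Allocation N, socialWelfare K q c θ v ≤ B) (i : Fin N) :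
    expect q c (fun ω => M.utility K s (fun _ => v) ω i (v i)) ≤
      T * B - M.seedRevenue K q c v s := by
  refine le_trans ?_ (sub_le_sub_right (M.expect_welfare_le K s (fun _ => v) hq hc v hB) _)
  rw [seedRevenue, ← expect_sub]
  refine expect_mono hq hc fun ω hω => ?_
  have h0 : ∀ j, 0 ≤ M.utility K s (fun _ => v) ω j (v j) := fun j => by
    have h2 := hI ω ⟨c, hc, hω⟩ (fun _ => v) (fun _ => hv) j (v j) (hv j)
    have h3 : reporting (fun _ : Fin T => v) j (v j) = fun _ => v := by
      funext t
      simp [reporting]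
    rwa [h3] at h2
  refine (Finset.single_le_sum (fun j _ => h0 j) (Finset.mem_univ i)).trans_eq ?_
  simp only [utility_eq, Finset.sum_sub_distrib]
  congr 1
  exact Finset.sum_comm

/-- The advertisers other than `h` keep a utility as if the users always went on after `h`, since
the mechanism cannot detect that they do not do so. -/
theorem sum_revenue_gap_ge (hK : 2 ≤ K) (hKN : K < N) (hq : ∀ i, q i ∈ Set.Ioc (0 : ℝ) 1)
    (hc : IsProbVector c) {h : Fin N} (hh : ∀ i ≠ h, c i = 0) (hpos : 0 < c h)
    (hD : ∀ ω : Fin T → UserState N, IsPossible q ω →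
      ∀ b : Fin T → Profile N, (∀ t, InRange V (b t)) → ∀ i : Fin N, ∀ x ∈ Set.Icc (0 : ℝ) V,
        M.utility K s b ω i x ≤ M.utility K s (reporting b i x) ω i x)
    (hI : ∀ ω : Fin T → UserState N, IsPossible q ω →
      ∀ b : Fin T → Profile N, (∀ t, InRange V (b t)) → ∀ i : Fin N, ∀ x ∈ Set.Icc (0 : ℝ) V,
        0 ≤ M.utility K s (reporting b i x) ω i x)
    {b x : Profile N} {W Δ B : ℝ} (hb : InRange V b) (hx : InRange V x) (hW : 0 < W) (hΔ : 0 < Δ)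
    (hxW : ∀ i ≠ h, q i * (x i - b i) = W) (hxΔ : q h * (x h - b h) = Δ)
    (hB : ∀ i ≠ h, ∀ θ : Allocation N, socialWelfare K q c θ (Function.update b i (x i)) ≤ B)
    (hB' : ∀ i ≠ h, ∀ θ : Allocation N,
      socialWelfare K q c θ (Function.update (Function.update b i (x i)) h (x h)) ≤ B) :
    (T : ℝ) ≤ ∑ i ∈ Finset.univ.erase h,
      (W⁻¹ * (T * B - M.seedRevenue K q c (Function.update b i (x i)) s) +
        Δ⁻¹ * (T * B - M.seedRevenue K q c
          (Function.update (Function.update b i (x i)) h (x h)) s)) := by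
  classical
  have hq' : IsProbVector q := fun i => ⟨(hq i).1.le, (hq i).2⟩
  let m₀ : Fin N := ⟨0, by omega⟩
  let m₁ : Fin N := ⟨1, by omega⟩
  let a : Fin N → Profile N := fun i => Function.update b i (x i)
  have hrange : ∀ {v : Profile N} (_ : InRange V v) (i : Fin N),
      InRange V (Function.update v i (x i)) := by
    intro v hv i j
    by_cases hj : j = i
    · subst hj; simpa using hx j
    · simpa [hj] using hv j
  let top : Fin N → (Fin T → UserState N) → Fin T → Fin N := fun i ω t =>
    M.allocAt K s (fun _ => a i) ω t m₀
  -- Rounds in which `h` is on top under no `a i`. Treating all `i` at once lets a single boosted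
  -- realization serve every advertiser.
  let g : (Fin T → UserState N) → Fin T → Prop := fun ω t =>
    ∀ i ∈ Finset.univ.erase h, top i ω t ≠ h
  have hg : ∀ ω ω' : Fin T → UserState N, ∀ t, (∀ r < t, ω r = ω' r) → (g ω t ↔ g ω' t) := by
    intro ω ω' t hr
    simp only [g, top, fun i => M.allocAt_congr K s (fun _ => a i) t hr]
  have hclicks : ∑ t, expect q c (fun ω => if g ω t then 1 else 0) ≤
      ∑ i ∈ Finset.univ.erase h,
        W⁻¹ * (T * B - M.seedRevenue K q c (a i) s) := by
    refine (expect_boost_clicks M K hK s (fun _ => b) (m := m₀) (m' := m₁) rfl rfl hq hc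
      hg).trans (Finset.sum_le_sum fun i hi => ?_)
    have hih := Finset.ne_of_mem_erase hi
    have h1 := expect_utility_le hq' hc hI (hrange hb i) (hB i hih) i
    have h2 : expect q c (fun ω => (x i - b i) *
        M.clickCount K s (fun _ => b) (boost h g ω) i) ≤
        expect q c (fun ω => M.utility K s (fun _ => a i) ω i (a i i)) := by
      refine expect_mono hq' hc fun ω hω => ?_
      have hω' := realizationProb_boost_pos (h := h) (g := g) hq' hc hpos hω
      have h3 := M.mul_clickCount_le_utility K s (hD _ ⟨c, hc, hω'⟩) (hI _ ⟨c, hc, hω'⟩) hb i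
        (hx i)
      refine h3.trans_eq ?_
      -- The boost is invisible under `a i`, so the utility at `ω` inherits the bound proved at the
      -- boosted realization.
      have h4 := M.utility_congr K s (fun _ => a i) (clicksAt_boost (h := h) (g := g) M K s
        (fun _ => a i) (m := m₀) rfl
        (fun t ht => ht i hi) fun t j hj => not_continue_of_pos hq' hc hω (hh j hj) t) i (x i)
      simpa [a] using h4
    rw [expect_const_mul] at h2
    have h3 : (q i)⁻¹ = W⁻¹ * (x i - b i) := by
      have := hxW i hih
      have hqi := (hq i).1.ne'
      field_simp
      linarith
    rw [h3, mul_assoc]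
    exact mul_le_mul_of_nonneg_left (h2.trans h1) (inv_nonneg.2 hW.le)
  have htop : ∀ i ∈ Finset.univ.erase h,
      ∑ t, expect q c (fun ω => if top i ω t = h then 1 else 0) ≤
        Δ⁻¹ * (T * B - M.seedRevenue K q c (Function.update (a i) h (x h)) s) := by
    intro i hi
    have hih := Finset.ne_of_mem_erase hi
    refine (M.expect_top_le K s (fun _ => a i) hq hc (m := m₀) rfl (by omega) h).trans ?_
    have h1 := expect_utility_le hq' hc hI (hrange (hrange hb i) h) (hB' i hih) h
    have h2 : expect q c (fun ω => (x h - b h) * M.clickCount K s (fun _ => a i) ω h) ≤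
        expect q c (fun ω => M.utility K s (fun _ => Function.update (a i) h (x h)) ω h
          (Function.update (a i) h (x h) h)) := by
      refine expect_mono hq' hc fun ω hω => ?_
      have h3 := M.mul_clickCount_le_utility K s (hD _ ⟨c, hc, hω⟩) (hI _ ⟨c, hc, hω⟩)
        (hrange hb i) h (hx h)
      simpa [a, hih.symm] using h3
    rw [expect_const_mul] at h2
    have h3 : (q h)⁻¹ = Δ⁻¹ * (x h - b h) := by
      have hqi := (hq h).1.ne'
      field_simp
      linarith
    rw [h3, mul_assoc]
    exact mul_le_mul_of_nonneg_left (h2.trans h1) (inv_nonneg.2 hΔ.le)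
  -- A round outside `g` has `h` on top under some `a i`.
  have hone : ∀ t : Fin T, (1 : ℝ) ≤ expect q c (fun ω => if g ω t then 1 else 0) +
      ∑ i ∈ Finset.univ.erase h, expect q c (fun ω => if top i ω t = h then 1 else 0) := by
    intro t
    rw [← expect_sum]
    have h1 : expect q c (fun ω => (1 : ℝ) - ∑ i ∈ Finset.univ.erase h,
        if top i ω t = h then 1 else 0) ≤ expect q c (fun ω => if g ω t then 1 else 0) := by
      refine expect_mono hq' hc fun ω _ => ?_
      have hnn : ∀ i ∈ Finset.univ.erase h, (0 : ℝ) ≤ if top i ω t = h then 1 else 0 :=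
        fun i _ => by split_ifs <;> norm_num
      by_cases hgt : g ω t
      · rw [if_pos hgt]
        linarith [Finset.sum_nonneg hnn]
      · rw [if_neg hgt]
        simp only [g, not_forall, not_not] at hgt
        obtain ⟨i, hi, ht⟩ := hgt
        have := Finset.single_le_sum hnn hi
        rw [if_pos ht] at this
        linarith
    rw [expect_sub, expect_const] at h1
    linarith
  calc (T : ℝ) = ∑ _t : Fin T, (1 : ℝ) := by simp
    _ ≤ ∑ t, (expect q c (fun ω => if g ω t then 1 else 0) +
        ∑ i ∈ Finset.univ.erase h, expect q c (fun ω => if top i ω t = h then 1 else 0)) :=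
        Finset.sum_le_sum fun t _ => hone t
    _ = ∑ t, expect q c (fun ω => if g ω t then 1 else 0) +
        ∑ i ∈ Finset.univ.erase h,
          ∑ t, expect q c (fun ω => if top i ω t = h then 1 else 0) := by
        rw [Finset.sum_add_distrib, Finset.sum_comm (s := Finset.univ)]
    _ ≤ _ := by
        rw [Finset.sum_add_distrib]
        exact add_le_add hclicks (Finset.sum_le_sum htop)

end OnlineMechanism

/-! ### Instances with linear regret -/

/-- Finitely many value profiles, one of which yields linear regret whatever the mechanism. -/
theorem exists_hard_instances {N K : ℕ} (hK : 2 ≤ K) (hKN : K < N) {V : ℝ} (hV : 0 < V)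
    {q : Fin N → ℝ} (hq : ∀ i, q i ∈ Set.Ioc (0 : ℝ) 1) :
    ∃ C : ℝ, 0 < C ∧ ∃ c : Fin N → ℝ, IsProbVector c ∧ ∃ I : Finset (Profile N),
      (∀ v ∈ I, InRange V v) ∧
      ∀ (T : ℕ) (M : OnlineMechanism.{u} N T), M.IsDSIC K V q → M.IsIR K V q →
        ∃ v ∈ I, C * T ≤ M.regret K q c v := by
  classical
  have hq' : IsProbVector q := fun i => ⟨(hq i).1.le, (hq i).2⟩
  have hn : (1 : ℝ) ≤ N := by exact_mod_cast (by omega : 1 ≤ N)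
  have hn0 : (0 : ℝ) < N := by linarith
  let h : Fin N := ⟨0, by omega⟩
  let h' : Fin N := ⟨1, by omega⟩
  have hh' : h' ≠ h := by
    rw [Ne, Fin.ext_iff]
    simp [h, h']
  -- The product of the qualities bounds each of them from below, so the values `W / q i` stay
  -- within `V`.
  obtain ⟨σ, hσ, hσV⟩ : ∃ σ : ℝ, 0 < σ ∧ ∀ i, 2 * σ ≤ V * q i := by
    refine ⟨V * (∏ i, q i) / 2, ?_, fun i => ?_⟩
    · have := Finset.prod_pos fun i (_ : i ∈ Finset.univ) => (hq i).1
      positivity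
    · have h1 : ∏ j, q j ≤ q i := by
        rw [← Finset.mul_prod_erase _ _ (Finset.mem_univ i)]
        exact mul_le_of_le_one_right (hq i).1.le
          (Finset.prod_le_one (fun j _ => (hq j).1.le) fun j _ => (hq j).2)
      have := mul_le_mul_of_nonneg_left h1 hV.le
      linarith
  -- The relative losses `ε`, `N * γ / ε` and `C / (ε * σ)` must be small fractions of `1 / N`,
  -- which dictates the orders `1 / N` for `ε`, `1 / N ^ 3` for `γ` and `σ / N ^ 2` for `C`.
  obtain ⟨ε, hε⟩ : ∃ ε : ℝ, ε = 1 / (4 * N) := ⟨_, rfl⟩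
  obtain ⟨γ, hγ⟩ : ∃ γ : ℝ, γ = 1 / (64 * (N : ℝ) ^ 3) := ⟨_, rfl⟩
  obtain ⟨W, hW⟩ : ∃ W : ℝ, W = (1 + ε) * σ := ⟨_, rfl⟩
  obtain ⟨C, hC⟩ : ∃ C : ℝ, C = σ / (64 * (N : ℝ) ^ 2) := ⟨_, rfl⟩
  have hε0 : 0 < ε := by rw [hε]; positivity
  have hε1 : ε ≤ 1 := by
    rw [hε, div_le_one (by positivity)]
    linarith
  have hγ0 : 0 < γ := by rw [hγ]; positivity
  have hγ1 : γ ≤ 1 := by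
    rw [hγ, div_le_one (by positivity)]
    have := one_le_pow₀ hn (n := 3)
    linarith
  have hC0 : 0 < C := by rw [hC]; positivity
  have hW0 : 0 < W := by rw [hW]; positivity
  have hσW : σ ≤ W := by rw [hW]; nlinarith
  have hW2 : W ≤ 2 * σ := by rw [hW]; nlinarith
  have hΔ0 : 0 < ε * σ := by positivity
  have hκ : W⁻¹ * (N * γ * W + ε * σ + C) + (ε * σ)⁻¹ * (N * γ * W + C) ≤ 1 / N := by
    have e1 : W⁻¹ * (N * γ * W + ε * σ + C) ≤ N * γ + ε + C / σ := by
      have : W⁻¹ * (N * γ * W + ε * σ + C) = N * γ + (ε * σ + C) / W := by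
        field_simp
        ring
      rw [this, add_assoc]
      refine add_le_add_right ((div_le_div_of_nonneg_left (by positivity) hσ hσW).trans_eq ?_) _
      field_simp
    have e2 : (ε * σ)⁻¹ * (N * γ * W + C) ≤ N * γ * 2 / ε + C / (ε * σ) := by
      have : N * γ * 2 / ε + C / (ε * σ) = (ε * σ)⁻¹ * (N * γ * (2 * σ) + C) := by
        field_simp
      rw [this]
      refine mul_le_mul_of_nonneg_left ?_ (inv_nonneg.2 hΔ0.le)
      exact add_le_add_left (mul_le_mul_of_nonneg_left hW2 (by positivity)) _
    have e3 : N * γ + ε + C / σ + (N * γ * 2 / ε + C / (ε * σ)) =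
        (1 / 32 / N + 1 / 4 + 1 / 8 + 1 / 16) * (1 / N) := by
      rw [hγ, hε, hC]
      field_simp
      ring
    have e4 : 1 / 32 / (N : ℝ) ≤ 1 / 32 := div_le_self (by norm_num) hn
    have e5 : (0 : ℝ) < 1 / N := by positivity
    calc _ ≤ N * γ + ε + C / σ + (N * γ * 2 / ε + C / (ε * σ)) := add_le_add e1 e2
      _ = (1 / 32 / N + 1 / 4 + 1 / 8 + 1 / 16) * (1 / N) := e3
      _ ≤ 1 * (1 / N) := mul_le_mul_of_nonneg_right (by linarith) e5.le
      _ = 1 / N := one_mul _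
  let c : Fin N → ℝ := fun i => if i = h then γ else 0
  have hch : c h = γ := if_pos rfl
  have hc0 : ∀ i ≠ h, c i = 0 := fun i hi => if_neg hi
  have hc : IsProbVector c := by
    intro i
    by_cases hi : i = h
    · rw [hi, hch]; exact ⟨hγ0.le, hγ1⟩
    · rw [hc0 i hi]; exact ⟨le_rfl, zero_le_one⟩
  let b : Profile N := fun i => if i = h then σ / q h else 0
  let x : Profile N := fun i => W / q i
  have hqx : ∀ i, q i * x i = W := fun i => mul_div_cancel₀ _ (hq i).1.ne'
  have hqb : q h * b h = σ := by
    simp only [b, if_true]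
    exact mul_div_cancel₀ _ (hq h).1.ne'
  have hb0 : ∀ i ≠ h, b i = 0 := fun i hi => if_neg hi
  have hx : InRange V x := fun i =>
    ⟨div_nonneg hW0.le (hq i).1.le, (div_le_iff₀ (hq i).1).2 (hW2.trans (hσV i))⟩
  have hb : InRange V b := by
    intro i
    by_cases hi : i = h
    · subst hi
      simp only [b, if_true]
      exact ⟨div_nonneg hσ.le (hq _).1.le,
        (div_le_iff₀ (hq _).1).2 ((hσW.trans hW2).trans (hσV _))⟩
    · rw [hb0 i hi]; exact ⟨le_rfl, hV.le⟩
  have hupd : ∀ {v : Profile N} (_ : InRange V v) (i : Fin N),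
      InRange V (Function.update v i (x i)) := by
    intro v hv i j
    by_cases hj : j = i
    · subst hj; simpa using hx j
    · simpa [hj] using hv j
  have hupdW : ∀ {v : Profile N} (_ : ∀ j, q j * v j ≤ W) (i j : Fin N),
      q j * Function.update v i (x i) j ≤ W := by
    intro v hv i j
    by_cases hj : j = i
    · subst hj; simpa using (hqx j).le
    · simpa [hj] using hv j
  have hbW : ∀ j, q j * b j ≤ W := by
    intro j
    by_cases hj : j = h
    · rw [hj, hqb]; exact hσW
    · rw [hb0 j hj, mul_zero]; exact hW0.le
  let a : Fin N → Profile N := fun i => Function.update b i (x i)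
  let d : Fin N → Profile N := fun i => Function.update (a i) h (x h)
  have hSW : ∀ {v : Profile N}, (∀ j, q j * v j ≤ W) → ∀ θ : Allocation N,
      socialWelfare K q c θ v ≤ (1 + γ) * W := by
    intro v hv θ
    have := socialWelfare_le_of_hub (K := K) (by omega) hc hc0 hW0.le hv θ
    rwa [hch] at this
  have hvcga : ∀ i ≠ h,
      (1 + γ) * W - ∑ j, vcgPayment K q c (a i) j ≤ N * γ * W + ε * σ := by
    intro i hi
    refine (sub_sum_vcgPayment_le (by omega) (hSW (hupdW hbW i))).trans ?_
    -- Removing `i` leaves the hub, worth `σ = W - ε * σ`; removing any other ad leaves `i`, worth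
    -- `W`.
    have hww : ∀ j, (1 + γ) * W - welfareWithout K q c (a i) j ≤
        γ * W + if j = i then ε * σ else 0 := by
      intro j
      by_cases hj : j = i
      · have := le_welfareWithout (K := K) (by omega) hKN hq' hc
          (fun j => (hupd hb i j).1) (hj.trans_ne hi)
        rw [Function.update_of_ne hi.symm, hqb] at this
        rw [if_pos hj]
        simp only [a]
        have hWσ : W = σ + ε * σ := by rw [hW]; ring
        linarith
      · have := le_welfareWithout (K := K) (by omega) hKN hq' hc
          (fun j => (hupd hb i j).1) hj
        rw [Function.update_self, hqx] at this
        rw [if_neg hj]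
        simp only [a]
        linarith
    refine (Finset.sum_le_sum fun j _ => hww j).trans_eq ?_
    rw [Finset.sum_add_distrib]
    simp [mul_assoc]
  have hvcgd : ∀ i ≠ h, (1 + γ) * W - ∑ j, vcgPayment K q c (d i) j ≤ N * γ * W := by
    intro i hi
    refine (sub_sum_vcgPayment_le (by omega) (hSW (hupdW (hupdW hbW i) h))).trans ?_
    -- Both `i` and `h` are worth `W`, and one of them survives any removal.
    have hww : ∀ j, (1 + γ) * W - welfareWithout K q c (d i) j ≤ γ * W := by
      intro j
      by_cases hj : j = i
      · have := le_welfareWithout (K := K) (by omega) hKN hq' hc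
          (fun j => (hupd (hupd hb i) h j).1) (hj.trans_ne hi)
        rw [Function.update_self, hqx] at this
        simp only [d, a]
        linarith
      · have := le_welfareWithout (K := K) (by omega) hKN hq' hc
          (fun j => (hupd (hupd hb i) h j).1) hj
        rw [Function.update_of_ne hi, Function.update_self, hqx] at this
        simp only [d, a]
        linarith
    refine (Finset.sum_le_sum fun j _ => hww j).trans_eq ?_
    simp [mul_assoc]
  refine ⟨C, hC0, c, hc, (Finset.univ.erase h).image a ∪ (Finset.univ.erase h).image d,
    fun v hv => ?_, fun T M hD hI => ?_⟩
  · rcases Finset.mem_union.1 hv with hv | hv <;> obtain ⟨i, -, rfl⟩ := Finset.mem_image.1 hv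
    · exact hupd hb i
    · exact hupd (hupd hb i) h
  · by_contra! hreg
    have hseed : ∀ᵐ s ∂M.law, (T : ℝ) ≤ ∑ i ∈ Finset.univ.erase h,
        (W⁻¹ * (T * ((1 + γ) * W) - M.seedRevenue K q c (a i) s) +
          (ε * σ)⁻¹ * (T * ((1 + γ) * W) - M.seedRevenue K q c (d i) s)) := by
      filter_upwards [hD, hI] with s hDs hIs
      refine OnlineMechanism.sum_revenue_gap_ge hK hKN hq hc hc0 (hch ▸ hγ0) hDs hIs hb hx hW0 hΔ0
        (fun i hi => ?_) ?_ (fun i _ => hSW (hupdW hbW i))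
        (fun i _ => hSW (hupdW (hupdW hbW i) h))
      · rw [hb0 i hi, sub_zero, hqx]
      · rw [mul_sub, hqx, hqb, hW]
        ring
    have hgap : ∀ v, Integrable (fun s => T * ((1 + γ) * W) - M.seedRevenue K q c v s) M.law :=
      fun v => (integrable_const _).sub (M.integrable_seedRevenue K q c v)
    have hterm : ∀ i, Integrable (fun s =>
        W⁻¹ * (T * ((1 + γ) * W) - M.seedRevenue K q c (a i) s) +
          (ε * σ)⁻¹ * (T * ((1 + γ) * W) - M.seedRevenue K q c (d i) s)) M.law :=
      fun i => ((hgap _).const_mul _).add ((hgap _).const_mul _)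
    have hint := integral_mono_ae (integrable_const (T : ℝ))
      (integrable_finsetSum (Finset.univ.erase h) fun i _ => hterm i) hseed
    have hgapint : ∀ v, ∫ s, (T * ((1 + γ) * W) - M.seedRevenue K q c v s) ∂M.law =
        T * ((1 + γ) * W - ∑ j, vcgPayment K q c v j) + M.regret K q c v := by
      intro v
      rw [integral_sub (integrable_const _) (M.integrable_seedRevenue K q c v),
        M.integral_seedRevenue, OnlineMechanism.regret]
      simp
      ring
    rw [integral_finsetSum _ fun i _ => hterm i] at hint
    simp only [fun i => integral_add ((hgap (a i)).const_mul W⁻¹)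
      ((hgap (d i)).const_mul (ε * σ)⁻¹), integral_const_mul, hgapint] at hint
    have hT : (0 : ℝ) ≤ T := Nat.cast_nonneg T
    have hlt : ∀ i ∈ Finset.univ.erase h,
        W⁻¹ * (T * ((1 + γ) * W - ∑ j, vcgPayment K q c (a i) j) + M.regret K q c (a i)) +
          (ε * σ)⁻¹ * (T * ((1 + γ) * W - ∑ j, vcgPayment K q c (d i) j) +
            M.regret K q c (d i)) < T * (1 / N) := by
      intro i hi
      have hih := Finset.ne_of_mem_erase hi
      have r1 := hreg (a i) (Finset.mem_union_left _ (Finset.mem_image_of_mem _ hi))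
      have r2 := hreg (d i) (Finset.mem_union_right _ (Finset.mem_image_of_mem _ hi))
      have p1 := mul_le_mul_of_nonneg_left (hvcga i hih) hT
      have p2 := mul_le_mul_of_nonneg_left (hvcgd i hih) hT
      have s1 := mul_lt_mul_of_pos_left (add_lt_add_of_le_of_lt p1 r1) (inv_pos.2 hW0)
      have s2 := mul_lt_mul_of_pos_left (add_lt_add_of_le_of_lt p2 r2) (inv_pos.2 hΔ0)
      refine (add_lt_add s1 s2).trans_le ((mul_le_mul_of_nonneg_left hκ hT).trans_eq' ?_)
      ring
    -- The second ad `h'` makes the sum nonempty, so strictness survives even for `T = 0`.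
    have hsum := Finset.sum_lt_sum_of_nonempty
      ⟨h', Finset.mem_erase.2 ⟨hh', Finset.mem_univ _⟩⟩ hlt
    have hcard : ∑ _i ∈ Finset.univ.erase h, (T : ℝ) * (1 / N) ≤ T := by
      calc ∑ _i ∈ Finset.univ.erase h, (T : ℝ) * (1 / N) ≤ ∑ _i : Fin N, (T : ℝ) * (1 / N) :=
            Finset.sum_le_sum_of_subset_of_nonneg (Finset.erase_subset _ _)
              fun _ _ _ => by positivity
        _ = T := by
            simp only [Finset.sum_const, Finset.card_univ, Fintype.card_fin, nsmul_eq_mul]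
            field_simp
    simp only [integral_const, probReal_univ, one_smul] at hint
    linarith

/-- The mechanism that always uses the same allocation and never charges anybody. -/
def freeMechanism (N T : ℕ) : OnlineMechanism.{u} N T where
  Seed := PUnit
  law := Measure.dirac PUnit.unit
  alloc _ _ _ _ := 1
  pay _ _ _ _ _ := 0
  measurable_alloc _ _ _ _ := MeasurableSet.of_discrete
  integrable_pay _ _ _ _ := integrable_const 0

/-- Neither clicks nor payments depend on the reports, and utility is just the value of the clicks.
-/
theorem freeMechanism_spec (N T K : ℕ) (V : ℝ) (q : Fin N → ℝ) :
    (freeMechanism.{u} N T).IsDSIC K V q ∧ (freeMechanism.{u} N T).IsIR K V q ∧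
      (freeMechanism.{u} N T).IsWBB K V q := by
  have hclicks : ∀ s b ω t, (freeMechanism.{u} N T).clicksAt K s b ω t = clicked K 1 (ω t) :=
    fun s b ω t => OnlineMechanism.clicksAt_eq _ K s b ω t
  have hpay : ∀ s b ω t, (freeMechanism.{u} N T).payAt K s b ω t = 0 := fun _ _ _ _ => rfl
  refine ⟨ae_of_all _ fun s ω _ b _ i x _ => ?_, ae_of_all _ fun s ω _ b _ i x hx => ?_,
    fun v c _ _ => ?_⟩
  · simp only [OnlineMechanism.utility, hclicks, hpay, le_refl]
  · simp only [OnlineMechanism.utility, hclicks, hpay, Pi.zero_apply, sub_zero]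
    exact Finset.sum_nonneg fun t _ => by split_ifs <;> simp [hx.1]
  · simp [OnlineMechanism.expectedRevenue, hpay]

end

end SponsoredSearch

/-! ### Assembly of the lower and upper bounds -/

open SponsoredSearch
theorem mainTheorem6 (N K : ℕ) (hK : 2 ≤ K) (hKN : K < N) (V : ℝ) (hV : 0 < V)
    (q : Fin N → ℝ) (hq : ∀ i, q i ∈ Set.Ioc (0 : ℝ) 1) :
    ∃ C₁ C₂ : ℝ, 0 < C₁ ∧ 0 < C₂ ∧
      (∀ (T : ℕ) (M : OnlineMechanism.{u} N T), M.IsDSIC K V q → M.IsIR K V q →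
        (∃ v c : Fin N → ℝ, InRange V v ∧ IsProbVector c ∧ C₁ * T ≤ M.regret K q c v) ∧
        (M.IsWBB K V q →
          ∀ v c : Fin N → ℝ, InRange V v → IsProbVector c → M.regret K q c v ≤ C₂ * T)) ∧
      (∀ M : ∀ T : ℕ, OnlineMechanism.{u} N T,
        (∀ T, (M T).IsDSIC K V q ∧ (M T).IsIR K V q) →
        ∃ v c : Fin N → ℝ, InRange V v ∧ IsProbVector c ∧
          ∃ᶠ T : ℕ in atTop, C₁ * T ≤ (M T).regret K q c v) ∧
      (∀ T : ℕ, ∃ M : OnlineMechanism.{u} N T,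
        M.IsDSIC K V q ∧ M.IsIR K V q ∧ M.IsWBB K V q) := by
  obtain ⟨C, hC, c, hc, I, hI, hreg⟩ := exists_hard_instances.{u} hK hKN hV hq
  have hN : (0 : ℝ) < N := by exact_mod_cast (by omega : 0 < N)
  refine ⟨C, N * (N * V), hC, by positivity, fun T M hD hR => ⟨?_, fun hB v c hv hc => ?_⟩,
    fun M hM => ?_, fun T => ⟨freeMechanism N T, freeMechanism_spec N T K V q⟩⟩
  · obtain ⟨v, hv, h⟩ := hreg T M hD hR
    exact ⟨v, c, hI v hv, hc, h⟩
  · have h1 := sum_vcgPayment_le (K := K) (by omega) hKN (fun i => ⟨(hq i).1.le, (hq i).2⟩) hc hv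
    have h2 := mul_le_mul_of_nonneg_left h1 (Nat.cast_nonneg (α := ℝ) T)
    have h3 := hB v c hv hc
    rw [OnlineMechanism.regret]
    linarith
  · by_contra! hnot
    -- If every profile of the finite set `I` were good for all large `T`, a single `T` would be
    -- good for all of them, contradicting `hreg`.
    have hev : ∀ v ∈ I, ∀ᶠ T : ℕ in atTop, ¬ C * T ≤ (M T).regret K q c v := fun v hv =>
      (hnot v c (hI v hv) hc).mono fun _ h => not_le.2 h
    obtain ⟨T, hT⟩ := ((eventually_all_finset I).2 hev).exists
    obtain ⟨v, hv, h⟩ := hreg T (M T) (hM T).1 (hM T).2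
    exact hT v hv h
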